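/- Let $\mathbb F_q$ be a finite field with $q$ elements, and let $a_i,b_i$ be integers with $0\le b_i\le a_i\le q-2$ for $i=1,2$. For $0\le b\le a\le q-2$ let $\square_{a,b}\subset\mathbb R^2$ be the polytope with vertices $(0,0),(a,0),(b,q-2),(0,q-2)$. For $v\in\mathbb Z^2$ let $C_{v+\square_{a,b}}\subseteq\mathbb F_q^{(q-1)^2}$ be the toric code, i.e. the span of the vectors $\bigl(x^{m_1}y^{m_2}\bigr)_{(x,y)\in(\mathbb F_q^*)^2}$ for the lattice points $m=(m_1,m_2)$ of $v+\square_{a,b}$ (all choices of $v$ give codes that differ only by multiplying coordinates by non-zero constants). Let $C^\perp$ denote the dual code for the standard bilinear form, and let $$k_i=\frac{(q-1)(a_i+b_i+1)+\gcd(a_i-b_i,q-2)+1}{2},\qquad i=1,2 .$$ An asymmetric quantum code with parameters $[[n,k,d_z/d_x]]_q$ is a subspace $Q$ of $\mathbb C^{q^n}=(\mathbb C^q)^{\otimes n}$ of dimension $q^k$ that corrects all bit-flip errors $\omega^cX(\mathbf a)$ on at most $\lfloor (d_x-1)/2\rfloor$ positions and all phase-shift errors $\omega^cZ(\mathbf b)$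 on at most $\lfloor (d_z-1)/2\rfloor$ positions, and detects those on at most $d_x-1$, respectively $d_z-1$, positions. Here $X(\mathbf a)|x\rangle=|x+\mathbf a\rangle$ and $Z(\mathbf b)|x\rangle=\omega^{\mathrm{tr}(\mathbf b\cdot x)}|x\rangle$ for $\mathbf a,\mathbf b,x\in\mathbb F_q^n$, $\omega=e^{2\pi i/p}$, $p=\operatorname{char}\mathbb F_q$, $c \in \mathbb F_p$, and $\mathrm{tr}$ is the trace from $\mathbb F_q$ to $\mathbb F_p$. **Theorem.** (1) Let $v\in\mathbb Z^2$, $C_1=C_{\square_{a_1,b_1}}$ and $C_2=C_{v+\square_{a_2,b_2}}$, and assume that the codes are nested: $C_1^\perp\subseteq C_2$. Then $\dim C_i=k_i$, $k_1+k_2\ge (q-1)^2$, and the CSS code of $C_1,C_2$, spanned by the vectors $\sum_{y\in C_1^\perp}|x+y\rangle$ for $x\in C_2$, is an asymmetric quantum code with parameters $$[[(q-1)^2,\;k_1+k_2-(q-1)^2,\;d_z/d_x]]_q\qquad\text{for some}\quad d_z\ge q-1-a_1,\quad d_x\ge q-1-a_2 .$$ (2) Put $a_2^\perp=q-2-b_2$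 and $b_2^\perp=q-2-a_2$. If the polytopes are nested, $\square_{a_2^\perp,b_2^\perp}\subseteq\square_{a_1,b_1}$, then the nestedness in (1) holds with $v=(1,1)$. -/

import Mathlib

open scoped InnerProductSpace

namespace ToricQuantum

noncomputable section

/-! ### Linear codes and toric codes -/

/-- The dual of a linear code `C ⊆ F^ι` for the standard bilinear form `∑ i, x i * y i`. -/
def dualCode {F ι : Type*} [Field F] [Fintype ι] (C : Submodule F (ι → F)) :
    Submodule F (ι → F) where
  carrier := {y | ∀ x ∈ C, ∑ i, x i * y i = 0}
  add_mem' := by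
    intro y z hy hz x hx
    simp [mul_add, Finset.sum_add_distrib, hy x hx, hz x hx]
  zero_mem' := by
    intro x _
    simp
  smul_mem' := by
    intro c y hy x hx
    have h : ∑ i, x i * (c • y) i = c * ∑ i, x i * y i := by
      rw [Finset.mul_sum]
      refine Finset.sum_congr rfl fun i _ => ?_
      simp only [Pi.smul_apply, smul_eq_mul]
      ring
    rw [h, hy x hx, mul_zero]

/-- The values of the Laurent monomial `X₁ ^ m₁ * X₂ ^ m₂` at the rational points
`(Fˣ) × (Fˣ)` of the two-dimensional torus. -/
def torusMonomial (F : Type*) [Field F] (m : ℤ × ℤ) : Fˣ × Fˣ → F :=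
  fun P => ((P.1 ^ m.1 * P.2 ^ m.2 : Fˣ) : F)

/-- The toric code of a set `U` of lattice points: all evaluations, at all rational points of the
torus, of linear combinations of the monomials with exponents in `U`. -/
def toricCode (F : Type*) [Field F] (U : Set (ℤ × ℤ)) : Submodule F (Fˣ × Fˣ → F) :=
  Submodule.span F (torusMonomial F '' U)

/-- The polytope with vertices `(0,0)`, `(a,0)`, `(b,q-2)`, `(0,q-2)`. -/
def polytope (q a b : ℕ) : Set (ℝ × ℝ) :=
  convexHull ℝ {((0 : ℝ), (0 : ℝ)), ((a : ℝ), (0 : ℝ)), ((b : ℝ), (q : ℝ) - 2),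
    ((0 : ℝ), (q : ℝ) - 2)}

/-- The lattice points of the polytope with vertices `(0,0)`, `(a,0)`, `(b,q-2)`, `(0,q-2)`,
translated by the lattice vector `v`. -/
def latticePoints (q a b : ℕ) (v : ℤ × ℤ) : Set (ℤ × ℤ) :=
  {m | ((((m - v).1 : ℤ) : ℝ), (((m - v).2 : ℤ) : ℝ)) ∈ polytope q a b}

/-! ### The error operators on `ℂ^(q^n)` -/

/-- The Hilbert space `ℂ^q ⊗ ⋯ ⊗ ℂ^q` (one factor for each `i : ι`), with orthonormal basis
indexed by `F^ι`. -/
abbrev QSpace (F ι : Type*) [Fintype F] [Fintype ι] [DecidableEq ι] : Type _ :=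
  EuclideanSpace ℂ (ι → F)

section Operators

variable {F ι : Type*} [Field F] [Fintype F] [DecidableEq F] [Fintype ι] [DecidableEq ι]

/-- The basis vector `|x⟩`, `x ∈ F^ι`. -/
def ket (x : ι → F) : QSpace F ι := EuclideanSpace.single x (1 : ℂ)

/-- The root of unity `ω = exp (2 π i / p)`, where `p` is the characteristic of `F`. -/
def omega (F : Type*) [Field F] : ℂ :=
  Complex.exp (2 * Real.pi * Complex.I / (ringChar F : ℂ))

/-- The trace from `F` to its prime field. -/
def primeTrace {F : Type*} [Field F] (t : F) : ZMod (ringChar F) :=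
  letI : Algebra (ZMod (ringChar F)) F := ZMod.algebra F (ringChar F)
  Algebra.trace (ZMod (ringChar F)) F t

/-- `X(a)`, the linear operator with `X(a)|x⟩ = |x + a⟩`. -/
def opX (a : ι → F) : QSpace F ι →ₗ[ℂ] QSpace F ι :=
  (EuclideanSpace.basisFun (ι → F) ℂ).toBasis.constr ℂ fun x => ket (x + a)

/-- `Z(b)`, the linear operator with `Z(b)|x⟩ = (∏ i, ω ^ tr (b i * x i)) |x⟩`. -/
def opZ (b : ι → F) : QSpace F ι →ₗ[ℂ] QSpace F ι :=
  (EuclideanSpace.basisFun (ι → F) ℂ).toBasis.constr ℂ fun x =>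
    (∏ i, omega F ^ (primeTrace (b i * x i)).val) • ket x

theorem opX_ket (a x : ι → F) : opX a (ket x) = ket (x + a) := by
  simp [opX, ket, Module.Basis.constr_apply_fintype]

theorem opZ_ket (b x : ι → F) :
    opZ b (ket x) = (∏ i, omega F ^ (primeTrace (b i * x i)).val) • ket x := by
  simp [opZ, ket, Module.Basis.constr_apply_fintype]

/-- The qubit-flip errors `ω ^ c X(a)` that affect at most `t` positions. -/
def bitFlipErrors (F ι : Type*) [Field F] [Fintype F] [DecidableEq F] [Fintype ι]
    [DecidableEq ι] (t : ℕ) : Set (QSpace F ι →ₗ[ℂ] QSpace F ι) :=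
  {E | ∃ (c : ZMod (ringChar F)) (a : ι → F), hammingNorm a ≤ t ∧ E = omega F ^ c.val • opX a}

/-- The phase-shift errors `ω ^ c Z(b)` that affect at most `t` positions. -/
def phaseShiftErrors (F ι : Type*) [Field F] [Fintype F] [DecidableEq F] [Fintype ι]
    [DecidableEq ι] (t : ℕ) : Set (QSpace F ι →ₗ[ℂ] QSpace F ι) :=
  {E | ∃ (c : ZMod (ringChar F)) (b : ι → F), hammingNorm b ≤ t ∧ E = omega F ^ c.val • opZ b}

/-- `Q` detects the error `E`: with `P` the orthogonal projection onto `Q`, the operator `P E P`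
is a multiple of `P`. -/
def Detects (Q : Submodule ℂ (QSpace F ι)) (E : QSpace F ι →ₗ[ℂ] QSpace F ι) : Prop :=
  ∃ c : ℂ, ∀ u ∈ Q, ∀ w ∈ Q, ⟪u, E w⟫_ℂ = c * ⟪u, w⟫_ℂ

/-- `Q` corrects (controls) the set `S` of errors: there is a quantum operation, with Kraus
operators `R j`, which returns every state of `Q` that was affected by an error from `S`
to its original value. -/
def Corrects (Q : Submodule ℂ (QSpace F ι)) (S : Set (QSpace F ι →ₗ[ℂ] QSpace F ι)) : Prop :=
  ∃ (m : ℕ) (R : Fin m → (QSpace F ι →ₗ[ℂ] QSpace F ι)),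
    (∑ j, LinearMap.adjoint (R j) ∘ₗ R j = LinearMap.id) ∧
    ∀ E ∈ S, ∀ j, ∃ c : ℂ, ∀ w ∈ Q, R j (E w) = c • w

/-- `Q` is an asymmetric quantum code with parameters `[[n, k, d_z/d_x]]_q`. -/
structure IsAsymmetricQuantumCode (Q : Submodule ℂ (QSpace F ι)) (q n k dz dx : ℕ) : Prop where
  alphabet : Fintype.card F = q
  length : Fintype.card ι = n
  dimension : Module.finrank ℂ Q = q ^ k
  corrects_bitFlip : Corrects Q (bitFlipErrors F ι ((dx - 1) / 2))
  corrects_phaseShift : Corrects Q (phaseShiftErrors F ι ((dz - 1) / 2))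
  detects_bitFlip : ∀ E ∈ bitFlipErrors F ι (dx - 1), Detects Q E
  detects_phaseShift : ∀ E ∈ phaseShiftErrors F ι (dz - 1), Detects Q E

open scoped Classical in
/-- The Calderbank-Shor-Steane code of a pair of linear codes (used when `C₁^⊥ ⊆ C₂`): the span
of the coset states `∑ y ∈ C₁^⊥, |x + y⟩`, for `x ∈ C₂`. -/
def cssCode (C₁ C₂ : Submodule F (ι → F)) : Submodule ℂ (QSpace F ι) :=
  Submodule.span ℂ
    ((fun x : ι → F => ∑ y : ι → F with y ∈ dualCode C₁, ket (x + y)) '' (C₂ : Set (ι → F)))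

end Operators

end

end ToricQuantum

open ToricQuantum

/-!
The proof joins a general fact on CSS codes to the combinatorics of toric codes.

*CSS codes.* Let `C₁^⊥ ≤ C₂`. A vector of the CSS code, viewed as a function on `F^ι`, is supported
on `C₂` and invariant under translation by `C₁^⊥`. Hence a bit flip `X(a)` with `a ∉ C₂` maps the
code to an orthogonal subspace (`inner_opX_eq_zero`), and so does a phase shift `Z(b)` with
`b ∉ C₁ = C₁^⊥^⊥`, since a translation by an element of `C₁^⊥` that is not orthogonal to `b` changes
`⟪u, Z(b) w⟫` by a factor different from `1` (`inner_opZ_eq_zero`). This applies to all non-zero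
`a`, `b` of weight less than the minimum distance of `C₂`, respectively `C₁`, and gives the
detection of errors. Since `X(a)* X(a') = X(a' - a)`, and likewise for `Z`, distinct errors of at most half
that weight map the code to pairwise orthogonal subspaces, and such a family of isometries is
corrected by explicit Kraus operators (`corrects_of_orthogonal`). The dimension is the number of
cosets of `C₁^⊥` in `C₂` (`finrank_cssCode`).

*Toric codes.* Put `n = q - 2`. The lattice points of `v + □_{a,b}` are distinct modulo `q - 1`, so
their monomials are distinct characters of the torus and hence linearly independent. The dimension
is therefore the number of lattice points, which the symmetry `y ↦ n - y` of the sum of the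
`⌊(a - b) y / n⌋` evaluates (`two_mul_card_rows`). On a line with constant second coordinate a word
is a monomial times a polynomial of degree at most `a`; this bounds the minimum distance
(`le_hammingNorm_of_mem_toricCode`). Finally, the orthogonality of characters shows that the dual of
the toric code of `U` is spanned by the monomials whose inverses are not in `U` modulo `q - 1`
(`dualCode_toricCode_le`), and the inclusion of polytopes places their exponents, represented
in `[1, q - 1]²`, in `(1, 1) + □_{a₂,b₂}`.
-/

namespace ToricQuantum

noncomputable section

/-! ### Duality of linear codes -/

section Duality

variable {F ι : Type*} [Field F] [Fintype ι]

theorem mem_dualCode {C : Submodule F (ι → F)} {y : ι → F} :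
    y ∈ dualCode C ↔ ∀ x ∈ C, ∑ i, x i * y i = 0 := Iff.rfl

theorem dualCode_eq_orthogonal [DecidableEq ι] (C : Submodule F (ι → F)) :
    dualCode C = (Matrix.toBilin' (1 : Matrix ι ι F)).orthogonal C := by
  ext y
  simp [mem_dualCode, LinearMap.BilinForm.mem_orthogonal_iff,
    Matrix.toBilin'_apply', dotProduct]

theorem nondegenerate_toBilin'_one [DecidableEq ι] :
    (Matrix.toBilin' (1 : Matrix ι ι F)).Nondegenerate :=
  LinearMap.BilinForm.nondegenerate_toBilin'_of_det_ne_zero' _ (by simp)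

theorem isRefl_toBilin'_one [DecidableEq ι] :
    (Matrix.toBilin' (1 : Matrix ι ι F)).IsRefl := by
  intro x y h
  rw [Matrix.toBilin'_apply'] at h ⊢
  simpa [dotProduct_comm] using h

theorem dualCode_dualCode (C : Submodule F (ι → F)) : dualCode (dualCode C) = C := by
  classical
  rw [dualCode_eq_orthogonal, dualCode_eq_orthogonal]
  exact LinearMap.BilinForm.orthogonal_orthogonal nondegenerate_toBilin'_one
    isRefl_toBilin'_one C

theorem finrank_add_finrank_dualCode (C : Submodule F (ι → F)) :
    Module.finrank F C + Module.finrank F (dualCode C) = Fintype.card ι := by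
  classical
  rw [dualCode_eq_orthogonal, LinearMap.BilinForm.finrank_orthogonal nondegenerate_toBilin'_one,
    Module.finrank_fintype_fun_eq_card]
  have := C.finrank_le
  rw [Module.finrank_fintype_fun_eq_card] at this
  omega

/-- A vector outside `C` is detected by some parity check of `C`. -/
theorem exists_mem_dualCode_sum_ne_zero {C : Submodule F (ι → F)} {b : ι → F} (hb : b ∉ C) :
    ∃ y ∈ dualCode C, ∑ i, b i * y i ≠ 0 := by
  rw [← dualCode_dualCode C, mem_dualCode] at hb
  push Not at hb
  obtain ⟨y, hy, h⟩ := hb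
  exact ⟨y, hy, by simpa [mul_comm] using h⟩

end Duality

/-! ### The additive character defined by the trace -/

section Character

variable (F : Type*) [Field F] [Finite F]

theorem ringChar_ne_zero_of_finite : ringChar F ≠ 0 :=
  CharP.char_ne_zero_of_finite F (ringChar F)

theorem isPrimitiveRoot_omega : IsPrimitiveRoot (omega F) (ringChar F) :=
  Complex.isPrimitiveRoot_exp _ (ringChar_ne_zero_of_finite F)

theorem norm_omega : ‖omega F‖ = 1 :=
  (isPrimitiveRoot_omega F).norm'_eq_one (ringChar_ne_zero_of_finite F)

/-- The additive character `t ↦ ω ^ tr t` of a finite field. -/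
def traceChar : AddChar F ℂ where
  toFun t := omega F ^ (primeTrace t).val
  map_zero_eq_one' := by simp [primeTrace]
  map_add_eq_mul' s t := by
    have : NeZero (ringChar F) := ⟨ringChar_ne_zero_of_finite F⟩
    have h : primeTrace (s + t) = primeTrace s + primeTrace t := by simp [primeTrace]
    rw [h, ZMod.val_add, ← pow_add]
    conv_rhs => rw [← Nat.mod_add_div ((primeTrace s).val + (primeTrace t).val) (ringChar F)]
    rw [pow_add, pow_mul, (isPrimitiveRoot_omega F).pow_eq_one, one_pow, mul_one]

variable {F}

theorem traceChar_apply (t : F) : traceChar F t = omega F ^ (primeTrace t).val := rfl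

theorem norm_traceChar (t : F) : ‖traceChar F t‖ = 1 := by
  simp [traceChar_apply, norm_omega]

/-- The character `ω ^ tr` is non-trivial on every line `F s`, because the trace form is
non-degenerate. -/
theorem exists_traceChar_mul_ne_one {s : F} (hs : s ≠ 0) : ∃ t, traceChar F (t * s) ≠ 1 := by
  have : NeZero (ringChar F) := ⟨ringChar_ne_zero_of_finite F⟩
  let _ : Algebra (ZMod (ringChar F)) F := ZMod.algebra F (ringChar F)
  obtain ⟨t, ht⟩ := FiniteField.trace_to_zmod_nondegenerate F hs
  refine ⟨t, fun h => ht ?_⟩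
  rw [traceChar_apply] at h
  have h1 := (isPrimitiveRoot_omega F).dvd_of_pow_eq_one _ h
  have h2 : (primeTrace (t * s)).val = 0 :=
    Nat.eq_zero_of_dvd_of_lt h1 (ZMod.val_lt _)
  rw [ZMod.val_eq_zero] at h2
  rw [mul_comm]
  exact h2

end Character

section Coordinates

/-! ### The error operators in coordinates -/

variable {F ι : Type*} [Fintype F] [Fintype ι] [DecidableEq ι]

theorem ket_apply [DecidableEq F] (x z : ι → F) :
    (ket x : QSpace F ι) z = if z = x then 1 else 0 := by
  simp [ket]

theorem inner_eq_sum (u w : QSpace F ι) : ⟪u, w⟫_ℂ = ∑ z, starRingEnd ℂ (u z) * w z := by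
  simp [PiLp.inner_apply, mul_comm]

end Coordinates

section Correction

variable {F ι : Type*} [Fintype F] [Fintype ι] [DecidableEq ι]

/-! ### Correction of mutually orthogonal errors -/

/-- If the isometries `U k` map `Q` to pairwise orthogonal subspaces, then the errors `U k` and
their multiples are corrected by `Q`. With `A k = U k * P`, where `P` is the projection onto `Q`,
the Kraus operators are the adjoints of the `A k`, which undo the errors, and the projection
`1 - ∑ k, A k * star (A k)` onto the complement of all the subspaces `U k Q`. -/
theorem corrects_of_orthogonal {κ : Type*} [Fintype κ] (Q : Submodule ℂ (QSpace F ι))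
    (U : κ → (QSpace F ι →ₗ[ℂ] QSpace F ι))
    (hU : ∀ k u w, ⟪U k u, U k w⟫_ℂ = ⟪u, w⟫_ℂ)
    (horth : ∀ k l, k ≠ l → ∀ u ∈ Q, ∀ w ∈ Q, ⟪U k u, U l w⟫_ℂ = 0)
    {S : Set (QSpace F ι →ₗ[ℂ] QSpace F ι)} (hS : ∀ E ∈ S, ∃ (c : ℂ) (k : κ), E = c • U k) :
    Corrects Q S := by
  classical
  let P : Module.End ℂ (QSpace F ι) := Q.starProjection.toLinearMap
  have hPmem : ∀ u, P u ∈ Q := fun u => Q.starProjection_apply_mem u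
  have hPid : ∀ u ∈ Q, P u = u := fun u hu => Submodule.starProjection_eq_self_iff.mpr hu
  have hPsym : ∀ u w, ⟪P u, w⟫_ℂ = ⟪u, P w⟫_ℂ := Q.inner_starProjection_left_eq_right
  let A : κ → Module.End ℂ (QSpace F ι) := fun k => U k * P
  have hAP : ∀ k, A k * P = A k := fun k => by
    ext1 u
    simp [A, hPid _ (hPmem u)]
  have hA : ∀ k l, star (A k) * A l = if k = l then P else 0 := by
    intro k l
    ext1 u
    refine ext_inner_left ℂ fun w => ?_
    rw [Module.End.mul_apply, LinearMap.star_eq_adjoint, LinearMap.adjoint_inner_right]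
    split_ifs with h
    · subst h
      simp only [A, Module.End.mul_apply, hU]
      rw [hPsym, hPid _ (hPmem u)]
    · simpa [A] using horth k l h _ (hPmem w) _ (hPmem u)
  let T : Module.End ℂ (QSpace F ι) := ∑ k, A k * star (A k)
  have hTA : ∀ l, T * A l = A l := fun l => by
    simp [T, Finset.sum_mul, mul_assoc, hA, hAP]
  have hTT : T * T = T := by
    conv_lhs => rw [show T * T = ∑ k, (T * A k) * star (A k) by
      simp only [mul_assoc]; rw [← Finset.mul_sum]]
    simp only [hTA, T]
  have hTs : star T = T := by simp [T]
  let R : Option κ → Module.End ℂ (QSpace F ι) := fun o => o.elim (1 - T) fun k => star (A k)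
  refine ⟨Fintype.card (Option κ), fun j => R ((Fintype.equivFin (Option κ)).symm j), ?_, ?_⟩
  · rw [Equiv.sum_comp (Fintype.equivFin (Option κ)).symm
      (fun o => LinearMap.adjoint (R o) ∘ₗ R o), Fintype.sum_option]
    change star (1 - T) * (1 - T) + ∑ k, star (star (A k)) * star (A k) = 1
    simp only [star_sub, star_one, hTs, star_star]
    change (1 - T) * (1 - T) + T = 1
    rw [mul_sub, sub_mul, sub_mul, hTT]
    simp
  · intro E hE j
    obtain ⟨c, l, rfl⟩ := hS E hE
    have hUA : ∀ w ∈ Q, U l w = A l w := fun w hw => by simp [A, hPid w hw]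
    dsimp only
    generalize (Fintype.equivFin (Option κ)).symm j = o
    rcases o with _ | k
    · refine ⟨0, fun w hw => ?_⟩
      have : (1 - T) (A l w) = 0 := by
        rw [LinearMap.sub_apply, ← Module.End.mul_apply T, hTA]
        simp
      simp [R, hUA w hw, this]
    · refine ⟨if k = l then c else 0, fun w hw => ?_⟩
      have : star (A k) (A l w) = if k = l then w else 0 := by
        rw [← Module.End.mul_apply, hA]
        split_ifs
        · exact hPid w hw
        · rfl
      simp [R, hUA w hw, this]

end Correction

section Operators

variable {F ι : Type*} [Field F] [Fintype F] [DecidableEq F] [Fintype ι] [DecidableEq ι]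

theorem opX_apply (a : ι → F) (u : QSpace F ι) (z : ι → F) : opX a u z = u (z - a) := by
  rw [opX, Module.Basis.constr_apply_fintype]
  simp [ket_apply, ← sub_eq_iff_eq_add]

theorem opZ_apply (b : ι → F) (u : QSpace F ι) (z : ι → F) :
    opZ b u z = traceChar F (∑ i, b i * z i) * u z := by
  rw [opZ, Module.Basis.constr_apply_fintype]
  have h : traceChar F (∑ i, b i * z i) = ∏ i, traceChar F (b i * z i) :=
    map_prod (traceChar F).toMonoidHom (fun i => Multiplicative.ofAdd (b i * z i)) _
  simp [h, ket_apply, ← traceChar_apply, mul_comm]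

theorem opX_zero : (opX 0 : QSpace F ι →ₗ[ℂ] QSpace F ι) = LinearMap.id := by
  ext1 u; ext z; simp [opX_apply]

theorem opZ_zero : (opZ 0 : QSpace F ι →ₗ[ℂ] QSpace F ι) = LinearMap.id := by
  ext1 u; ext z; simp [opZ_apply]

theorem inner_opX_opX (a a' : ι → F) (u w : QSpace F ι) :
    ⟪opX a u, opX a' w⟫_ℂ = ⟪u, opX (a' - a) w⟫_ℂ := by
  simp only [inner_eq_sum, opX_apply]
  refine Fintype.sum_equiv (Equiv.subRight a) _ _ fun z => ?_
  simp

theorem inner_opZ_opZ (b b' : ι → F) (u w : QSpace F ι) :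
    ⟪opZ b u, opZ b' w⟫_ℂ = ⟪u, opZ (b' - b) w⟫_ℂ := by
  simp only [inner_eq_sum, opZ_apply]
  refine Finset.sum_congr rfl fun z _ => ?_
  have h : starRingEnd ℂ (traceChar F (∑ i, b i * z i)) * traceChar F (∑ i, b i * z i) = 1 := by
    rw [← Complex.normSq_eq_conj_mul_self, Complex.normSq_eq_norm_sq, norm_traceChar]
    simp
  have h' : traceChar F (∑ i, b' i * z i) =
      traceChar F (∑ i, b i * z i) * traceChar F (∑ i, (b' - b) i * z i) := by
    rw [← AddChar.map_add_eq_mul, ← Finset.sum_add_distrib]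
    congr 1
    refine Finset.sum_congr rfl fun i _ => ?_
    simp; ring
  rw [h', map_mul]
  linear_combination starRingEnd ℂ (u z) * traceChar F (∑ i, (b' - b) i * z i) * w z * h

/-! ### CSS codes -/

theorem sum_ket_apply (D : Submodule F (ι → F)) [DecidablePred (· ∈ D)] (x z : ι → F) :
    (∑ y : ι → F with y ∈ D, (ket (x + y) : QSpace F ι)) z = if z - x ∈ D then 1 else 0 := by
  simp only [WithLp.ofLp_sum, Finset.sum_apply, ket_apply, ← sub_eq_iff_eq_add',
    Finset.sum_ite_eq, Finset.mem_filter, Finset.mem_univ, true_and]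

variable {C₁ C₂ : Submodule F (ι → F)}

/-- The vectors of the CSS code are supported on `C₂`. -/
theorem apply_eq_zero_of_mem_cssCode (hC : dualCode C₁ ≤ C₂) {u : QSpace F ι}
    (hu : u ∈ cssCode C₁ C₂) {z : ι → F} (hz : z ∉ C₂) : u z = 0 := by
  classical
  induction hu using Submodule.span_induction with
  | mem u hu =>
    obtain ⟨x, hx, rfl⟩ := hu
    simp only [sum_ket_apply]
    refine if_neg fun h => hz ?_
    simpa using C₂.add_mem (hC h) hx
  | zero => rfl
  | add u w _ _ hu hw => simp [hu, hw]
  | smul c u _ hu => simp [hu]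

/-- The vectors of the CSS code are invariant under translation by `C₁^⊥`. -/
theorem apply_add_of_mem_cssCode {u : QSpace F ι} (hu : u ∈ cssCode C₁ C₂) (z : ι → F)
    {y : ι → F} (hy : y ∈ dualCode C₁) : u (z + y) = u z := by
  classical
  induction hu using Submodule.span_induction with
  | mem u hu =>
    obtain ⟨x, hx, rfl⟩ := hu
    simp only [sum_ket_apply]
    rw [show z + y - x = z - x + y by abel, (dualCode C₁).add_mem_iff_left hy]
  | zero => rfl
  | add u w _ _ hu hw => simp [hu, hw]
  | smul c u _ hu => simp [hu]

/-- A bit flip outside `C₂` moves the CSS code to an orthogonal subspace, by disjointness of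
supports. -/
theorem inner_opX_eq_zero (hC : dualCode C₁ ≤ C₂) {u w : QSpace F ι} (hu : u ∈ cssCode C₁ C₂)
    (hw : w ∈ cssCode C₁ C₂) {a : ι → F} (ha : a ∉ C₂) : ⟪u, opX a w⟫_ℂ = 0 := by
  rw [inner_eq_sum]
  refine Finset.sum_eq_zero fun z _ => ?_
  rw [opX_apply]
  by_cases hz : z ∈ C₂
  · rw [apply_eq_zero_of_mem_cssCode hC hw (z := z - a), mul_zero]
    intro h
    exact ha (by simpa using C₂.sub_mem hz h)
  · simp [apply_eq_zero_of_mem_cssCode hC hu hz]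

/-- A phase shift outside `C₁` moves the CSS code to an orthogonal subspace: translation by a
suitable element of `C₁^⊥` multiplies the inner product by a constant different from `1`. -/
theorem inner_opZ_eq_zero {u w : QSpace F ι} (hu : u ∈ cssCode C₁ C₂)
    (hw : w ∈ cssCode C₁ C₂) {b : ι → F} (hb : b ∉ C₁) : ⟪u, opZ b w⟫_ℂ = 0 := by
  obtain ⟨y, hy, hby⟩ := exists_mem_dualCode_sum_ne_zero hb
  obtain ⟨t, ht⟩ := exists_traceChar_mul_ne_one hby
  have hty : t • y ∈ dualCode C₁ := (dualCode C₁).smul_mem t hy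
  have key : ⟪u, opZ b w⟫_ℂ = traceChar F (t * ∑ i, b i * y i) * ⟪u, opZ b w⟫_ℂ := by
    simp only [inner_eq_sum, opZ_apply]
    conv_lhs => rw [← Equiv.sum_comp (Equiv.addRight (t • y))]
    rw [Finset.mul_sum]
    refine Finset.sum_congr rfl fun z _ => ?_
    rw [Equiv.coe_addRight, apply_add_of_mem_cssCode hu z hty, apply_add_of_mem_cssCode hw z hty]
    have : ∑ i, b i * (z + t • y) i = t * ∑ i, b i * y i + ∑ i, b i * z i := by
      rw [Finset.mul_sum, ← Finset.sum_add_distrib]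
      refine Finset.sum_congr rfl fun i _ => ?_
      simp; ring
    rw [this, AddChar.map_add_eq_mul]
    ring
  by_contra hne
  exact ht (mul_right_cancel₀ hne (by rw [one_mul]; exact key.symm))

/-- The coset states form a basis of the CSS code indexed by `C₂ / C₁^⊥`. -/
theorem finrank_cssCode (hC : dualCode C₁ ≤ C₂) :
    Module.finrank ℂ (cssCode C₁ C₂) = Fintype.card F ^
      (Module.finrank F C₁ + Module.finrank F C₂ - Fintype.card ι) := by
  classical
  let D : Submodule F C₂ := (dualCode C₁).comap C₂.subtype
  let s : (ι → F) → QSpace F ι := fun x => ∑ y : ι → F with y ∈ dualCode C₁, ket (x + y)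
  have hs : ∀ x z, s x z = if z - x ∈ dualCode C₁ then 1 else 0 := sum_ket_apply _
  have hmk : ∀ x z : C₂, (z : ι → F) - x ∈ dualCode C₁ ↔ D.mkQ z = D.mkQ x := fun x z => by
    rw [Submodule.mkQ_apply, Submodule.mkQ_apply, Submodule.Quotient.eq]
    rfl
  let g : C₂ ⧸ D → QSpace F ι := fun k => s (Quotient.out k : C₂)
  have hout : ∀ k : C₂ ⧸ D, D.mkQ (Quotient.out k) = k := fun k => Quotient.out_eq k
  have hspan : cssCode C₁ C₂ = Submodule.span ℂ (Set.range g) := by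
    rw [cssCode]
    congr 1
    ext u
    constructor
    · rintro ⟨x, hx, rfl⟩
      refine ⟨D.mkQ ⟨x, hx⟩, ?_⟩
      ext z
      change s _ z = s x z
      rw [hs, hs]
      have h : x - ((Quotient.out (D.mkQ ⟨x, hx⟩) : C₂) : ι → F) ∈ dualCode C₁ :=
        (hmk _ ⟨x, hx⟩).mpr (hout _).symm
      rw [← (dualCode C₁).add_mem_iff_left (x := z - x) h, sub_add_sub_cancel]
    · rintro ⟨k, rfl⟩
      exact ⟨_, (Quotient.out k : C₂).2, rfl⟩
  have hli : LinearIndependent ℂ g := by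
    rw [Fintype.linearIndependent_iff]
    intro c hc k
    have := congrArg (fun u : QSpace F ι => u (Quotient.out k : C₂)) hc
    simpa [g, hs, hmk, hout] using this
  have hcard := Module.card_eq_pow_finrank (K := F) (V := C₂ ⧸ D)
  have h1 := D.finrank_quotient_add_finrank
  have h2 : Module.finrank F D = Module.finrank F (dualCode C₁) :=
    (Submodule.comapSubtypeEquivOfLe hC).finrank_eq
  have h3 := finrank_add_finrank_dualCode C₁
  rw [hspan, finrank_span_eq_card hli, hcard]
  congr 1
  omega

/-- The CSS code of `C₁`, `C₂` has the parameters given by the dimensions of `C₁`, `C₂` and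
by lower bounds for their minimum distances. -/
theorem isAsymmetricQuantumCode_cssCode (hC : dualCode C₁ ≤ C₂) {dz dx : ℕ}
    (hz : 0 < dz) (hx : 0 < dx)
    (hC₁ : ∀ c ∈ C₁, c ≠ 0 → dz ≤ hammingNorm c) (hC₂ : ∀ c ∈ C₂, c ≠ 0 → dx ≤ hammingNorm c) :
    IsAsymmetricQuantumCode (cssCode C₁ C₂) (Fintype.card F) (Fintype.card ι)
      (Module.finrank F C₁ + Module.finrank F C₂ - Fintype.card ι) dz dx := by
  have hsub : ∀ {d : ℕ} {a b : ι → F}, hammingNorm a ≤ (d - 1) / 2 → hammingNorm b ≤ (d - 1) / 2 →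
      hammingNorm (b - a) ≤ d - 1 := fun {d a b} ha hb => by
    have := hammingDist_triangle a 0 b
    rw [hammingDist_zero_right, hammingDist_zero_left, hammingDist_eq_hammingNorm,
      neg_add_eq_sub] at this
    omega
  have hX : ∀ a : ι → F, hammingNorm a ≤ dx - 1 → a ≠ 0 → a ∉ C₂ := fun a ha h0 hm => by
    have := hC₂ a hm h0; omega
  have hZ : ∀ b : ι → F, hammingNorm b ≤ dz - 1 → b ≠ 0 → b ∉ C₁ := fun a ha h0 hm => by
    have := hC₁ a hm h0; omega
  refine ⟨rfl, rfl, finrank_cssCode hC, ?_, ?_, ?_, ?_⟩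
  · refine corrects_of_orthogonal (κ := {a : ι → F // hammingNorm a ≤ (dx - 1) / 2}) _
      (fun a => opX a.1) (fun a u w => ?_) (fun a a' h u hu w hw => ?_) ?_
    · simp [inner_opX_opX, opX_zero]
    · rw [inner_opX_opX]
      exact inner_opX_eq_zero hC hu hw
        (hX _ (hsub a.2 a'.2) (sub_ne_zero.mpr fun h' => h (Subtype.ext h'.symm)))
    · rintro _ ⟨c, a, ha, rfl⟩
      exact ⟨_, ⟨a, ha⟩, rfl⟩
  · refine corrects_of_orthogonal (κ := {b : ι → F // hammingNorm b ≤ (dz - 1) / 2}) _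
      (fun b => opZ b.1) (fun b u w => ?_) (fun b b' h u hu w hw => ?_) ?_
    · simp [inner_opZ_opZ, opZ_zero]
    · rw [inner_opZ_opZ]
      exact inner_opZ_eq_zero hu hw
        (hZ _ (hsub b.2 b'.2) (sub_ne_zero.mpr fun h' => h (Subtype.ext h'.symm)))
    · rintro _ ⟨c, b, hb, rfl⟩
      exact ⟨_, ⟨b, hb⟩, rfl⟩
  · rintro _ ⟨c, a, ha, rfl⟩
    by_cases h : a = 0
    · subst h
      exact ⟨omega F ^ c.val, fun u _ w _ => by simp [opX_zero]⟩
    · refine ⟨0, fun u hu w hw => ?_⟩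
      rw [LinearMap.smul_apply, inner_smul_right, inner_opX_eq_zero hC hu hw (hX a ha h)]
      simp
  · rintro _ ⟨c, b, hb, rfl⟩
    by_cases h : b = 0
    · subst h
      exact ⟨omega F ^ c.val, fun u _ w _ => by simp [opZ_zero]⟩
    · refine ⟨0, fun u hu w hw => ?_⟩
      rw [LinearMap.smul_apply, inner_smul_right, inner_opZ_eq_zero hu hw (hZ b hb h)]
      simp

end Operators

/-! ### Lattice points of the polytope -/

section LatticePoints

/-- The polytope as an intersection of half-planes. The inequality `x ≤ a` follows from the others
unless `n = 0`. -/
theorem mem_polytope_iff {n a b : ℕ} (hb : b ≤ a) (ha : a ≤ n) (p : ℝ × ℝ) :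
    p ∈ polytope (n + 2) a b ↔
      0 ≤ p.1 ∧ p.1 ≤ a ∧ 0 ≤ p.2 ∧ p.2 ≤ n ∧ (n : ℝ) * p.1 + ((a : ℝ) - b) * p.2 ≤ n * a := by
  have hn2 : ((n + 2 : ℕ) : ℝ) - 2 = n := by push_cast; ring
  have hb' : (b : ℝ) ≤ a := by exact_mod_cast hb
  have ha' : (a : ℝ) ≤ n := by exact_mod_cast ha
  have hb0 : (0 : ℝ) ≤ b := b.cast_nonneg
  rw [polytope, hn2]
  constructor
  · let H : Set (ℝ × ℝ) := {p | 0 ≤ p.1 ∧ p.1 ≤ a ∧ 0 ≤ p.2 ∧ p.2 ≤ n ∧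
      (n : ℝ) * p.1 + ((a : ℝ) - b) * p.2 ≤ n * a}
    have hH : Convex ℝ H := by
      rintro ⟨x, y⟩ ⟨h1, h2, h3, h4, h5⟩ ⟨x', y'⟩ ⟨h1', h2', h3', h4', h5'⟩ s t hs ht hst
      obtain rfl : s = 1 - t := by linarith
      simp only [H, Set.mem_ofPred_eq, Prod.smul_mk, Prod.mk_add_mk, smul_eq_mul] at *
      have e := mul_le_mul_of_nonneg_left h5 hs
      have e' := mul_le_mul_of_nonneg_left h5' ht
      exact ⟨by positivity, by nlinarith, by positivity, by nlinarith, by linarith⟩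
    refine fun hp => (convexHull_min ?_ hH : _ ⊆ H) hp
    rintro _ (rfl | rfl | rfl | rfl) <;> simp only [H, Set.mem_ofPred_eq] <;>
      refine ⟨?_, ?_, ?_, ?_, ?_⟩ <;> nlinarith
  · rintro ⟨h1, h2, h3, h4, h5⟩
    obtain ⟨x, y⟩ := p
    simp only at h1 h2 h3 h4 h5
    -- `t` is the height of the point relative to `n`, and `s` is its position on the horizontal
    -- section of the polytope at that height, which has the length `w`
    obtain ⟨t, ht0, ht1, hy⟩ : ∃ t : ℝ, 0 ≤ t ∧ t ≤ 1 ∧ y = t * n := by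
      rcases (Nat.cast_nonneg n : (0 : ℝ) ≤ n).eq_or_lt with hn | hn
      · exact ⟨0, le_rfl, zero_le_one, by linarith⟩
      · exact ⟨y / n, by positivity, (div_le_one hn).mpr h4, by field_simp⟩
    have hx : x ≤ (1 - t) * a + t * b := by
      rcases (Nat.cast_nonneg n : (0 : ℝ) ≤ n).eq_or_lt with hn | hn
      · nlinarith
      · refine le_of_mul_le_mul_left ?_ hn
        rw [hy] at h5
        linarith
    obtain ⟨s, hs0, hs1, hx'⟩ : ∃ s : ℝ, 0 ≤ s ∧ s ≤ 1 ∧ x = s * ((1 - t) * a + t * b) := by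
      set w : ℝ := (1 - t) * a + t * b
      rcases (h1.trans hx).eq_or_lt with hw | hw
      · exact ⟨0, le_rfl, zero_le_one, by linarith⟩
      · exact ⟨x / w, by positivity, (div_le_one hw).mpr hx, by field_simp⟩
    have hc := convex_convexHull ℝ ({((0 : ℝ), (0 : ℝ)), ((a : ℝ), (0 : ℝ)), ((b : ℝ), (n : ℝ)),
      ((0 : ℝ), (n : ℝ))} : Set (ℝ × ℝ))
    have hsub := subset_convexHull ℝ ({((0 : ℝ), (0 : ℝ)), ((a : ℝ), (0 : ℝ)), ((b : ℝ), (n : ℝ)),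
      ((0 : ℝ), (n : ℝ))} : Set (ℝ × ℝ))
    have hl := hc (hsub (by simp : ((0 : ℝ), (0 : ℝ)) ∈ _))
      (hsub (by simp : ((0 : ℝ), (n : ℝ)) ∈ _)) (sub_nonneg.mpr ht1) ht0 (by ring)
    have hr := hc (hsub (by simp : ((a : ℝ), (0 : ℝ)) ∈ _))
      (hsub (by simp : ((b : ℝ), (n : ℝ)) ∈ _)) (sub_nonneg.mpr ht1) ht0 (by ring)
    convert hc hl hr (sub_nonneg.mpr hs1) hs0 (by ring) using 1
    ext <;> simp [hx', hy]
    ring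

theorem mem_latticePoints_iff {n a b : ℕ} (hb : b ≤ a) (ha : a ≤ n) (m v : ℤ × ℤ) :
    m ∈ latticePoints (n + 2) a b v ↔ 0 ≤ m.1 - v.1 ∧ m.1 - v.1 ≤ a ∧ 0 ≤ m.2 - v.2 ∧
      m.2 - v.2 ≤ n ∧ (n : ℤ) * (m.1 - v.1) + ((a : ℤ) - b) * (m.2 - v.2) ≤ n * a := by
  rw [latticePoints, Set.mem_ofPred_eq, mem_polytope_iff hb ha]
  simp only [Prod.fst_sub, Prod.snd_sub]
  norm_cast

/-- The lattice points of the polytope, row by row: the pair `⟨y, x⟩` stands for the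
point `(x, y)`. -/
def rows (n a b : ℕ) : Finset (Σ _ : ℕ, ℕ) :=
  (Finset.range (n + 1)).sigma fun y => Finset.range (b + (a - b) * (n - y) / n + 1)

/-- For `n = 0` the junk value `_ / 0 = 0` in `rows` is correct, since then `a = b = 0`. -/
theorem mem_rows {n a b : ℕ} (hb : b ≤ a) (ha : a ≤ n) (r : Σ _ : ℕ, ℕ) :
    r ∈ rows n a b ↔ r.2 ≤ a ∧ r.1 ≤ n ∧ (n : ℤ) * r.2 + ((a : ℤ) - b) * r.1 ≤ n * a := by
  obtain ⟨y, x⟩ := r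
  obtain ⟨d, rfl⟩ := Nat.exists_eq_add_of_le hb
  simp only [rows, Finset.mem_sigma, Finset.mem_range, Nat.lt_succ_iff, Nat.add_sub_cancel_left]
  rcases Nat.eq_zero_or_pos n with rfl | hn
  · have h1 : b = 0 := by omega
    have h2 : d = 0 := by omega
    subst h1 h2
    simp [and_comm]
  constructor
  · rintro ⟨hy, hx⟩
    obtain ⟨z, rfl⟩ := Nat.exists_eq_add_of_le hy
    rw [Nat.add_sub_cancel_left] at hx
    have h1 : d * z / (y + z) * (y + z) ≤ d * z := Nat.div_mul_le_self _ _
    have h2 : d * z / (y + z) ≤ d := Nat.div_le_of_le_mul (by nlinarith)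
    refine ⟨by omega, hy, ?_⟩
    have h3 : (y + z) * x + d * y ≤ (y + z) * (b + d) := by nlinarith
    zify at h3
    push_cast
    linarith
  · rintro ⟨hx, hy, h⟩
    obtain ⟨z, rfl⟩ := Nat.exists_eq_add_of_le hy
    refine ⟨hy, ?_⟩
    have h3 : (y + z) * x + d * y ≤ (y + z) * (b + d) := by
      zify
      push_cast at h
      linarith
    rw [Nat.add_sub_cancel_left, ← Nat.sub_le_iff_le_add', Nat.le_div_iff_mul_le hn]
    rcases le_total b x with hbx | hbx
    · obtain ⟨c, rfl⟩ := Nat.exists_eq_add_of_le hbx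
      rw [Nat.add_sub_cancel_left]
      nlinarith
    · simp [Nat.sub_eq_zero_of_le hbx]

theorem latticePoints_eq_image {n a b : ℕ} (hb : b ≤ a) (ha : a ≤ n) (v : ℤ × ℤ) :
    latticePoints (n + 2) a b v =
      Set.range fun r : rows n a b => ((r.1.2 : ℤ) + v.1, (r.1.1 : ℤ) + v.2) := by
  ext m
  rw [mem_latticePoints_iff hb ha]
  constructor
  · rintro ⟨h1, h2, h3, h4, h5⟩
    obtain ⟨x, hx⟩ := Int.eq_ofNat_of_zero_le h1
    obtain ⟨y, hy⟩ := Int.eq_ofNat_of_zero_le h3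
    rw [hx, hy] at h5
    refine ⟨⟨⟨y, x⟩, (mem_rows hb ha _).mpr ⟨by grind, by grind, h5⟩⟩, ?_⟩
    ext <;> grind
  · rintro ⟨⟨r, hr⟩, rfl⟩
    obtain ⟨h1, h2, h3⟩ := (mem_rows hb ha _).mp hr
    simp only [add_sub_cancel_right]
    exact ⟨by positivity, by exact_mod_cast h1, by positivity, by exact_mod_cast h2, h3⟩

end LatticePoints

/-! ### The number of lattice points -/

section Counting

/-- The condition `n ∣ d * y` means that `y` is a multiple of `n / gcd d n`. -/
theorem card_filter_dvd_mul {n : ℕ} (hn : 0 < n) (d : ℕ) :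
    ((Finset.range (n + 1)).filter fun y => n ∣ d * y).card = Nat.gcd d n + 1 := by
  have hg : 0 < Nat.gcd d n := Nat.gcd_pos_of_pos_right d hn
  have h1 : ∀ y, n ∣ d * y ↔ n / Nat.gcd d n ∣ y := fun y => by
    constructor
    · intro h
      refine (Nat.coprime_div_gcd_div_gcd hg).symm.dvd_of_dvd_mul_left ?_
      rw [← Nat.mul_dvd_mul_iff_right hg]
      convert h using 1
      · exact Nat.div_mul_cancel (Nat.gcd_dvd_right d n)
      · rw [mul_right_comm, Nat.div_mul_cancel (Nat.gcd_dvd_left d n)]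
    · rintro ⟨c, rfl⟩
      obtain ⟨e, he⟩ := Nat.gcd_dvd_left d n
      refine ⟨e * c, ?_⟩
      calc d * (n / Nat.gcd d n * c) = Nat.gcd d n * e * (n / Nat.gcd d n * c) := by rw [← he]
        _ = (n / Nat.gcd d n * Nat.gcd d n) * (e * c) := by ring
        _ = n * (e * c) := by rw [Nat.div_mul_cancel (Nat.gcd_dvd_right d n)]
  have h2 : Finset.range (n + 1) = insert 0 (Finset.Ioc 0 n) := by
    ext y; simp
  simp only [h1]
  rw [h2, Finset.filter_insert, if_pos (dvd_zero _), Finset.card_insert_of_notMem (by simp),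
    Nat.Ioc_filter_dvd_card_eq_div, Nat.div_div_self (Nat.gcd_dvd_right d n) hn.ne']

/-- The two fractions add up to the integer `d`, so their floors add up to `d` or `d - 1`. -/
theorem div_add_div_reflect {n d y : ℕ} (hn : 0 < n) (hy : y ≤ n) :
    d * y / n + d * (n - y) / n + 1 = d + if n ∣ d * y then 1 else 0 := by
  have hs : d * y + d * (n - y) = d * n := by rw [← mul_add, Nat.add_sub_cancel' hy]
  have h1 := Nat.add_div (a := d * y) (b := d * (n - y)) hn
  rw [hs, Nat.mul_div_cancel _ hn] at h1
  have h2 : n ∣ d * y % n + d * (n - y) % n := by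
    rw [Nat.dvd_iff_mod_eq_zero, ← Nat.add_mod, hs, Nat.mul_mod_left]
  have h3 : d * (n - y) % n < n := Nat.mod_lt _ hn
  by_cases h : d * y % n = 0
  · rw [h, if_neg (by omega)] at h1
    rw [if_pos (Nat.dvd_of_mod_eq_zero h)]
    omega
  · rw [if_pos (Nat.le_of_dvd (by omega) h2)] at h1
    rw [if_neg fun h' => h (Nat.mod_eq_zero_of_dvd h')]
    omega

/-- The sum of the floors of `d * y / n`, from the symmetry `y ↦ n - y`. -/
theorem two_mul_sum_div {n : ℕ} (hn : 0 < n) (d : ℕ) :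
    2 * ∑ y ∈ Finset.range (n + 1), d * y / n + (n + 1) = (n + 1) * d + Nat.gcd d n + 1 := by
  have h1 := Finset.sum_range_reflect (fun y => d * y / n) (n + 1)
  have h2 : ∑ y ∈ Finset.range (n + 1), (d * y / n + d * (n - y) / n + 1) =
      ∑ y ∈ Finset.range (n + 1), (d + if n ∣ d * y then 1 else 0) :=
    Finset.sum_congr rfl fun y hy =>
      div_add_div_reflect hn (Nat.lt_succ_iff.mp (Finset.mem_range.mp hy))
  simp only [Finset.sum_add_distrib, Finset.sum_const, Finset.card_range, smul_eq_mul, mul_one,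
    ← Finset.card_filter, card_filter_dvd_mul hn] at h2
  simp only [Nat.add_sub_cancel] at h1
  omega

theorem two_mul_card_rows {n a b : ℕ} (hb : b ≤ a) (ha : a ≤ n) :
    2 * (rows n a b).card = (n + 1) * (a + b + 1) + Nat.gcd (a - b) n + 1 := by
  rcases Nat.eq_zero_or_pos n with rfl | hn
  · obtain rfl : a = 0 := by omega
    obtain rfl : b = 0 := by omega
    simp [rows]
  · obtain ⟨d, rfl⟩ := Nat.exists_eq_add_of_le hb
    have h1 := Finset.sum_range_reflect (fun y => d * y / n) (n + 1)
    have h2 := two_mul_sum_div hn d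
    simp only [Nat.add_sub_cancel] at h1
    simp only [rows, Finset.card_sigma, Finset.card_range, Nat.add_sub_cancel_left,
      Finset.sum_add_distrib, Finset.sum_const, smul_eq_mul, h1]
    linarith

end Counting

/-! ### Monomials on the torus as characters -/

section Monomials

variable {F : Type*} [Field F]

theorem torusMonomial_mul (m m' : ℤ × ℤ) (P : Fˣ × Fˣ) :
    torusMonomial F m P * torusMonomial F m' P = torusMonomial F (m + m') P := by
  simp only [torusMonomial, Prod.fst_add, Prod.snd_add, zpow_add, ← Units.val_mul]
  congr 1
  exact mul_mul_mul_comm _ _ _ _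

/-- A Laurent monomial as a multiplicative character of the torus. -/
def torusCharacter (m : ℤ × ℤ) : Fˣ × Fˣ →* F :=
  (Units.coeHom F).comp
    ((zpowGroupHom m.1).comp (MonoidHom.fst _ _) * (zpowGroupHom m.2).comp (MonoidHom.snd _ _))

variable [Fintype F] {n : ℕ}

theorem dvd_of_forall_zpow_eq (hF : Fintype.card F = n + 2) {i j : ℤ}
    (h : ∀ x : Fˣ, x ^ i = x ^ j) : ((n + 1 : ℕ) : ℤ) ∣ i - j := by
  classical
  obtain ⟨g, hg⟩ := IsCyclic.exists_ofOrder_eq_natCard (α := Fˣ)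
  rw [Nat.card_eq_fintype_card, Fintype.card_units, hF] at hg
  rw [show n + 1 = n + 2 - 1 by rfl, ← hg, orderOf_dvd_iff_zpow_eq_one, zpow_sub, h, mul_inv_cancel]

/-- Monomials with exponents that are distinct modulo `q - 1` are linearly independent on the
torus, because they are distinct characters. -/
theorem linearIndependent_torusMonomial (hF : Fintype.card F = n + 2) {κ : Type*} (e : κ → ℤ × ℤ)
    (he : ∀ k l, ((n + 1 : ℕ) : ℤ) ∣ (e k).1 - (e l).1 → ((n + 1 : ℕ) : ℤ) ∣ (e k).2 - (e l).2 →
      k = l) :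
    LinearIndependent F fun k => torusMonomial F (e k) := by
  refine (linearIndependent_monoidHom (Fˣ × Fˣ) F).comp (fun k => torusCharacter (e k))
    fun k l hkl => ?_
  have h : ∀ x y : Fˣ, x ^ (e k).1 * y ^ (e k).2 = x ^ (e l).1 * y ^ (e l).2 := fun x y =>
    Units.ext (DFunLike.congr_fun hkl (x, y))
  exact he k l (dvd_of_forall_zpow_eq hF fun x => by simpa using h x 1)
    (dvd_of_forall_zpow_eq hF fun y => by simpa using h 1 y)

theorem sum_units_zpow [DecidableEq F] (hF : Fintype.card F = n + 2) (i : ℤ) :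
    ∑ x : Fˣ, ((x ^ i : Fˣ) : F) = if ((n + 1 : ℕ) : ℤ) ∣ i then -1 else 0 := by
  have hcard : Fintype.card Fˣ = n + 1 := by rw [Fintype.card_units, hF]; rfl
  have hpos : (0 : ℤ) < (n + 1 : ℕ) := by positivity
  obtain ⟨r, hr⟩ := Int.eq_ofNat_of_zero_le (Int.emod_nonneg i hpos.ne')
  have h : ∀ x : Fˣ, ((x ^ i : Fˣ) : F) = (x : F) ^ r := fun x => by
    rw [← zpow_mod_card, hcard, hr, zpow_natCast, Units.val_pow_eq_pow_val]
  simp only [h]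
  rw [FiniteField.sum_pow_units, hF]
  have hlt : r < n + 1 := by
    have := Int.emod_lt_of_pos i hpos
    rw [hr] at this
    exact_mod_cast this
  have hdvd : n + 2 - 1 ∣ r ↔ ((n + 1 : ℕ) : ℤ) ∣ i := by
    rw [Int.dvd_iff_emod_eq_zero, hr, Int.natCast_eq_zero]
    exact ⟨fun hd => Nat.eq_zero_of_dvd_of_lt hd hlt, fun h0 => h0 ▸ dvd_zero _⟩
  simp only [hdvd]

theorem sum_torusMonomial [DecidableEq F] (hF : Fintype.card F = n + 2) (m : ℤ × ℤ) :
    ∑ P : Fˣ × Fˣ, torusMonomial F m P =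
      if ((n + 1 : ℕ) : ℤ) ∣ m.1 ∧ ((n + 1 : ℕ) : ℤ) ∣ m.2 then 1 else 0 := by
  simp only [torusMonomial, Units.val_mul, Fintype.sum_prod_type, ← Finset.mul_sum,
    ← Finset.sum_mul, sum_units_zpow hF]
  split_ifs <;> simp_all

end Monomials

/-! ### Toric codes -/

section ToricCode

variable {F : Type*} [Field F] {n a b : ℕ}

theorem finrank_toricCode [Fintype F] (hF : Fintype.card F = n + 2) (hb : b ≤ a) (ha : a ≤ n)
    (v : ℤ × ℤ) :
    Module.finrank F (toricCode F (latticePoints (n + 2) a b v)) = (rows n a b).card := by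
  rw [toricCode, latticePoints_eq_image hb ha, ← Set.range_comp]
  refine (finrank_span_eq_card (linearIndependent_torusMonomial hF _ ?_)).trans
    (Fintype.card_coe _)
  rintro ⟨⟨y, x⟩, hr⟩ ⟨⟨y', x'⟩, hr'⟩ h1 h2
  obtain ⟨hx, hy, -⟩ := (mem_rows hb ha _).mp hr
  obtain ⟨hx', hy', -⟩ := (mem_rows hb ha _).mp hr'
  simp only [add_sub_add_right_eq_sub] at h1 h2 hx hy hx' hy'
  have e1 := Int.eq_zero_of_abs_lt_dvd h1 (by rw [abs_lt]; omega)
  have e2 := Int.eq_zero_of_abs_lt_dvd h2 (by rw [abs_lt]; omega)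
  obtain rfl : x = x' := by omega
  obtain rfl : y = y' := by omega
  rfl

open Polynomial in
/-- On each line of the torus with constant second coordinate, a word of the toric code is a
monomial times a polynomial of degree at most `a`. -/
theorem exists_polynomial_of_mem_toricCode (hb : b ≤ a) (ha : a ≤ n) {v : ℤ × ℤ}
    {c : Fˣ × Fˣ → F} (hc : c ∈ toricCode F (latticePoints (n + 2) a b v)) (y : Fˣ) :
    ∃ p : F[X], p.natDegree ≤ a ∧ ∀ x : Fˣ, c (x, y) = ((x ^ v.1 : Fˣ) : F) * p.eval (x : F) := by
  induction hc using Submodule.span_induction with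
  | mem c hc =>
    obtain ⟨m, hm, rfl⟩ := hc
    obtain ⟨h1, h2, -⟩ := (mem_latticePoints_iff hb ha m v).mp hm
    obtain ⟨i, hi⟩ := Int.eq_ofNat_of_zero_le h1
    refine ⟨C ((y ^ m.2 : Fˣ) : F) * X ^ i, (natDegree_C_mul_X_pow_le _ _).trans (by omega),
      fun x => ?_⟩
    have : m.1 = v.1 + (i : ℤ) := by omega
    simp only [torusMonomial, this, zpow_add, zpow_natCast, Units.val_mul, Units.val_pow_eq_pow_val,
      eval_mul, eval_C, eval_pow, eval_X]
    ring
  | zero => exact ⟨0, by simp, by simp⟩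
  | add c c' _ _ hc hc' =>
    obtain ⟨p, hp, h⟩ := hc
    obtain ⟨p', hp', h'⟩ := hc'
    exact ⟨p + p', natDegree_add_le_of_degree_le hp hp', fun x => by
      simp [h, h', mul_add]⟩
  | smul t c _ hc =>
    obtain ⟨p, hp, h⟩ := hc
    exact ⟨C t * p, (natDegree_C_mul_le t p).trans hp, fun x => by simp [h]; ring⟩

variable [Fintype F] [DecidableEq F]

/-- On a line of the torus where a word does not vanish identically, it has at most `a` zeros among
the `n + 1` points. -/
theorem le_hammingNorm_of_mem_toricCode (hF : Fintype.card F = n + 2)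
    (hb : b ≤ a) (ha : a ≤ n) {v : ℤ × ℤ} {c : Fˣ × Fˣ → F}
    (hc : c ∈ toricCode F (latticePoints (n + 2) a b v)) (hc0 : c ≠ 0) :
    n + 1 - a ≤ hammingNorm c := by
  obtain ⟨⟨x₀, y⟩, h0⟩ := Function.ne_iff.mp hc0
  obtain ⟨p, hp, h⟩ := exists_polynomial_of_mem_toricCode hb ha hc y
  have hp0 : p ≠ 0 := by
    rintro rfl
    exact h0 (by simp [h])
  have hzero : (Finset.univ.filter fun x : Fˣ => c (x, y) = 0).card ≤ a := by
    refine le_trans ?_ ((Multiset.toFinset_card_le p.roots).trans (p.card_roots'.trans hp))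
    refine Finset.card_le_card_of_injOn (fun x : Fˣ => (x : F)) (fun x hx => ?_)
      (fun x _ x' _ hxx => Units.ext hxx)
    have hx' : c (x, y) = 0 := by simpa using hx
    rw [h, mul_eq_zero] at hx'
    simpa [hp0] using hx'.resolve_left (Units.ne_zero _)
  have hsum := Finset.card_filter_add_card_filter_not (s := (Finset.univ : Finset Fˣ))
    (fun x => c (x, y) = 0)
  rw [Finset.card_univ, Fintype.card_units, hF] at hsum
  have hle : (Finset.univ.filter fun x : Fˣ => ¬ c (x, y) = 0).card ≤ hammingNorm c := by
    refine Finset.card_le_card_of_injOn (fun x => (x, y)) (fun x hx => ?_)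
      (fun x _ x' _ hxx => congrArg Prod.fst hxx)
    simpa using hx
  omega

/-- A word that is orthogonal to the monomials with exponents in `U` is a combination of the
monomials with exponents in `V`, provided that every residue class modulo `q - 1` meets `-U` or `V`;
the exponents `1, …, q - 1` represent the classes. -/
theorem dualCode_toricCode_le (hF : Fintype.card F = n + 2) {U V : Set (ℤ × ℤ)}
    (hUV : ∀ i j : ℕ, i ≤ n → j ≤ n →
      ((n : ℤ) - i, (n : ℤ) - j) ∈ U ∨ ((i : ℤ) + 1, (j : ℤ) + 1) ∈ V) :
    dualCode (toricCode F U) ≤ toricCode F V := by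
  intro f hf
  let e : Fin (n + 1) × Fin (n + 1) → ℤ × ℤ := fun k => ((k.1 : ℤ) + 1, (k.2 : ℤ) + 1)
  have key : ∀ i j : Fin (n + 1), ((n + 1 : ℕ) : ℤ) ∣ (i : ℤ) - j → i = j := fun i j h => by
    have := Int.eq_zero_of_abs_lt_dvd h (by rw [abs_lt]; omega)
    omega
  have hli : LinearIndependent F fun k => torusMonomial F (e k) :=
    linearIndependent_torusMonomial hF e fun k l h1 h2 =>
      Prod.ext (key _ _ (by simpa [e] using h1)) (key _ _ (by simpa [e] using h2))
  have htop := hli.span_eq_top_of_card_eq_finrank' (by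
    rw [Module.finrank_fintype_fun_eq_card, Fintype.card_prod, Fintype.card_prod,
      Fintype.card_units, Fintype.card_fin, hF]
    rfl)
  obtain ⟨c, rfl⟩ := (Submodule.mem_span_range_iff_exists_fun F).mp
    (htop ▸ Submodule.mem_top : f ∈ Submodule.span F (Set.range fun k => torusMonomial F (e k)))
  refine Submodule.sum_mem _ fun k _ => ?_
  have hk1 : (k.1 : ℕ) ≤ n := Nat.lt_succ_iff.mp k.1.2
  have hk2 : (k.2 : ℕ) ≤ n := Nat.lt_succ_iff.mp k.2.2
  rcases hUV k.1 k.2 hk1 hk2 with hU | hV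
  · -- the coefficient `c k` is the inner product of the word with the inverse of the monomial `k`
    have hck : c k = 0 := by
      have h := hf _ (Submodule.subset_span (Set.mem_image_of_mem _ hU))
      simp only [Finset.sum_apply, Pi.smul_apply, smul_eq_mul, Finset.mul_sum] at h
      rw [Finset.sum_comm] at h
      simp only [mul_left_comm, torusMonomial_mul, ← Finset.mul_sum, sum_torusMonomial hF] at h
      rw [Finset.sum_eq_single k] at h
      · rw [if_pos] at h
        · simpa using h
        · constructor <;> refine dvd_of_eq ?_ <;> simp only [e, Prod.mk_add_mk] <;> push_cast <;>
            ring
      · intro l _ hl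
        rw [if_neg, mul_zero]
        rintro ⟨h1, h2⟩
        refine hl (Prod.ext (key _ _ ?_) (key _ _ ?_))
        · obtain ⟨t, ht⟩ := h1
          refine ⟨t - 1, ?_⟩
          simp only [e, Prod.mk_add_mk] at ht
          push_cast at ht ⊢
          linarith
        · obtain ⟨t, ht⟩ := h2
          refine ⟨t - 1, ?_⟩
          simp only [e, Prod.mk_add_mk] at ht
          push_cast at ht ⊢
          linarith
      · simp
    simp [hck]
  · exact Submodule.smul_mem _ _ (Submodule.subset_span (Set.mem_image_of_mem _ hV))

/-- If `m` is a point of the square `[0, n]²` outside the polytope of `a₂`, `b₂`, then its mirror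
image `(n, n) - m` lies in the polytope of `n - b₂`, `n - a₂`. So, if the latter is contained in the
polytope of `a₁`, `b₁`, then `dualCode_toricCode_le` applies; the shift by `(1, 1)` comes from the
representatives `1, …, q - 1` used there. -/
theorem dualCode_le_of_polytope_subset (hF : Fintype.card F = n + 2)
    {a₁ b₁ a₂ b₂ : ℕ}
    (hb₂ : b₂ ≤ a₂) (ha₂ : a₂ ≤ n)
    (h : polytope (n + 2) (n - b₂) (n - a₂) ⊆ polytope (n + 2) a₁ b₁) :
    dualCode (toricCode F (latticePoints (n + 2) a₁ b₁ 0)) ≤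
      toricCode F (latticePoints (n + 2) a₂ b₂ (1, 1)) := by
  have hsub : latticePoints (n + 2) (n - b₂) (n - a₂) 0 ⊆ latticePoints (n + 2) a₁ b₁ 0 :=
    fun m hm => h hm
  refine dualCode_toricCode_le hF fun i j hi hj => ?_
  refine or_iff_not_imp_left.mpr fun hU => ?_
  replace hU := fun h' => hU (hsub h')
  rw [mem_latticePoints_iff (by omega) (by omega)] at hU
  rw [mem_latticePoints_iff hb₂ ha₂]
  simp only [Prod.fst_zero, Prod.snd_zero, sub_zero, add_sub_cancel_right,
    Nat.cast_sub ha₂, Nat.cast_sub (hb₂.trans ha₂)] at hU ⊢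
  zify at hi hj hb₂ ha₂
  have hi0 : (0 : ℤ) ≤ i := by positivity
  have hj0 : (0 : ℤ) ≤ j := by positivity
  by_cases hib : (i : ℤ) < b₂
  · refine ⟨hi0, by omega, hj0, hj, ?_⟩
    nlinarith
  · have hlt : (n : ℤ) * i + ((a₂ : ℤ) - b₂) * j < n * a₂ := by
      by_contra hge
      refine hU ⟨by omega, by omega, by omega, by omega, ?_⟩
      nlinarith
    refine ⟨hi0, ?_, hj0, hj, hlt.le⟩
    by_contra hgt
    nlinarith [mul_nonneg (sub_nonneg.mpr hb₂) hj0]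

end ToricCode

end

end ToricQuantum

theorem mainTheorem4 (F : Type*) [Field F] [Fintype F] [DecidableEq F] (q : ℕ)
    (hq : Fintype.card F = q) (a₁ b₁ a₂ b₂ : ℕ)
    (hb₁ : b₁ ≤ a₁) (ha₁ : a₁ ≤ q - 2) (hb₂ : b₂ ≤ a₂) (ha₂ : a₂ ≤ q - 2) :
    (∀ v : ℤ × ℤ,
      dualCode (toricCode F (latticePoints q a₁ b₁ 0)) ≤ toricCode F (latticePoints q a₂ b₂ v) →
      ∃ k₁ k₂ dz dx : ℕ,
        (k₁ : ℚ) =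
          (((q : ℚ) - 1) * ((a₁ : ℚ) + b₁ + 1) + (Nat.gcd (a₁ - b₁) (q - 2) : ℚ) + 1) / 2 ∧
        (k₂ : ℚ) =
          (((q : ℚ) - 1) * ((a₂ : ℚ) + b₂ + 1) + (Nat.gcd (a₂ - b₂) (q - 2) : ℚ) + 1) / 2 ∧
        Module.finrank F (toricCode F (latticePoints q a₁ b₁ 0)) = k₁ ∧
        Module.finrank F (toricCode F (latticePoints q a₂ b₂ v)) = k₂ ∧
        (q - 1) ^ 2 ≤ k₁ + k₂ ∧
        q - 1 - a₁ ≤ dz ∧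
        q - 1 - a₂ ≤ dx ∧
        IsAsymmetricQuantumCode
          (cssCode (toricCode F (latticePoints q a₁ b₁ 0)) (toricCode F (latticePoints q a₂ b₂ v)))
          q ((q - 1) ^ 2) (k₁ + k₂ - (q - 1) ^ 2) dz dx) ∧
    (polytope q (q - 2 - b₂) (q - 2 - a₂) ⊆ polytope q a₁ b₁ →
      dualCode (toricCode F (latticePoints q a₁ b₁ 0)) ≤
        toricCode F (latticePoints q a₂ b₂ (1, 1))) := by
  obtain ⟨n, rfl⟩ : ∃ n, q = n + 2 :=
    ⟨q - 2, by have := Fintype.one_lt_card (α := F); omega⟩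
  rw [Nat.add_sub_cancel] at ha₁ ha₂
  refine ⟨fun v hC => ?_, dualCode_le_of_polytope_subset hq hb₂ ha₂⟩
  have hdim : ∀ {a b : ℕ}, b ≤ a → a ≤ n → ((rows n a b).card : ℚ) =
      ((((n + 2 : ℕ) : ℚ) - 1) * ((a : ℚ) + b + 1) +
        (Nat.gcd (a - b) (n + 2 - 2) : ℚ) + 1) / 2 := fun {a b} hb ha => by
    have h : (2 * (rows n a b).card : ℚ) =
        (n + 1) * (a + b + 1) + (Nat.gcd (a - b) n : ℚ) + 1 := by
      exact_mod_cast two_mul_card_rows hb ha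
    rw [Nat.add_sub_cancel]
    push_cast
    linarith
  have hlen : Fintype.card (Fˣ × Fˣ) = (n + 2 - 1) ^ 2 := by
    rw [Fintype.card_prod, Fintype.card_units, hq, sq]
  have h1 := finrank_toricCode hq hb₁ ha₁ 0
  have h2 := finrank_toricCode hq hb₂ ha₂ v
  have hcode := isAsymmetricQuantumCode_cssCode hC
    (dz := n + 1 - a₁) (dx := n + 1 - a₂) (by omega) (by omega)
    (fun c hc hc0 => le_hammingNorm_of_mem_toricCode hq hb₁ ha₁ hc hc0)
    (fun c hc hc0 => le_hammingNorm_of_mem_toricCode hq hb₂ ha₂ hc hc0)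
  rw [h1, h2, hq, hlen] at hcode
  have hsum := finrank_add_finrank_dualCode (toricCode F (latticePoints (n + 2) a₁ b₁ 0))
  rw [hlen, h1] at hsum
  have hle := Submodule.finrank_mono hC
  rw [h2] at hle
  exact ⟨_, _, _, _, hdim hb₁ ha₁, hdim hb₂ ha₂, h1, h2, by omega, le_rfl, le_rfl, hcode⟩
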